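/- **Contracts.** Values are elements of $\mathbb{R}+\mathbb{B}$; each observable label $l$ has a type $\Lambda(l)\in\{\mathsf{Real},\mathsf{Bool}\}$. Expressions are $e ::= r \mid b \mid \mathsf{obs}(l,i) \mid op(e_1,\dots,e_n)$ with $r\in\mathbb{R}$, $b\in\mathbb{B}$, $i\in\mathbb{Z}$ and the usual arithmetic, comparison and boolean operators and a conditional $\mathsf{cond}(e_0,e_1,e_2)$. Template expressions $t$ are numerals $n\in\mathbb{N}$ or template variables $v$. Contracts are $$c ::= \mathsf{zero} \mid \mathsf{transfer}(p,q,a) \mid \mathsf{scale}(e,c)\mid \mathsf{translate}(t,c)\mid \mathsf{both}(c,c)\mid \mathsf{ifWithin}(e,t,c,c).$$ (Expression variables, $\mathsf{let}$ and $\mathsf{acc}$, which the compiler does not support, are left out.) A contract is *template-closed* if it contains no template variable. It is *well-typed*, $\vdash c$, if every scaling factor is a real expression and every $\mathsf{ifWithin}$ condition a boolean one, expressions being typed in the obvious way with $\mathsf{obs}(l,i):\Lambda(l)$. *Causal typing.* $e:\tau^t$ ($t\in\mathbb{Z}$) means that $e$ has type $\tau$ and all its observables $\mathsf{obs}(l,i)$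 have $i\le t$. For a template environment $\delta$ (a map from template variables to $\mathbb{N}$, with $[\![n]\!]\delta=n$, $[\![v]\!]\delta=\delta(v)$), the judgement $c:\mathrm{Contr}^t$ is given by: $\mathsf{zero}:\mathrm{Contr}^t$; $\mathsf{transfer}(p,q,a):\mathrm{Contr}^t$ if $t\le 0$; $\mathsf{scale}(e,c):\mathrm{Contr}^t$ if $e:\mathsf{Real}^s$ and $c:\mathrm{Contr}^s$ for some $s\ge t$; $\mathsf{translate}(u,c):\mathrm{Contr}^{t+[\![u]\!]\delta}$ if $c:\mathrm{Contr}^t$; $\mathsf{both}(c_1,c_2):\mathrm{Contr}^t$ if $c_1,c_2:\mathrm{Contr}^t$; $\mathsf{ifWithin}(e,u,c_1,c_2):\mathrm{Contr}^t$ if $e:\mathsf{Bool}^0$, $c_1:\mathrm{Contr}^t$, $c_2:\mathrm{Contr}^{t-[\![u]\!]\delta}$. Call $c$ *causally typed* if $c:\mathrm{Contr}^t$ for some $t$. **Environments.** An external environment $\rho$ maps each label and each $i\in\mathbb{Z}$ to a value; it is well-typed if $\rho(l,i)$ has type $\Lambda(l)$. A partial environment $\rho'$ is a partial map of the same kind;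 it is *historically complete* if $\rho'(l,i)$ is defined for all $l$ and all $i\le 0$. Write $(\rho/n)(l,i)=\rho(l,i+n)$, likewise $\rho'/n$, and $(d/n)(t)=d(t+n)$ for a discount function $d:\mathbb{N}\to\mathbb{R}$. **Reduction.** For template-closed contracts, the relation $c\Rightarrow^{T}_{\rho'}c'$ ("in one time step $c$ prescribes the transfers $T$ and becomes $c'$"), with $T:\mathrm{Party}\times\mathrm{Party}\times\mathrm{Asset}\to\mathbb{R}$, is generated by the following rules, where $[\![e]\!]_{\rho'}$ is the strict partial value of $e$ at $\rho'$ and $-1\Uparrow e$ is $e$ with every $\mathsf{obs}(l,i)$ replaced by $\mathsf{obs}(l,i-1)$: - $\mathsf{zero}\Rightarrow^{0}\mathsf{zero}$; $\mathsf{transfer}(p,q,a)\Rightarrow^{T_{p,q,a}}\mathsf{zero}$, where $T_{p,q,a}$ is $0$ if $p=q$, and otherwise is $1$ at $(p,q,a)$, $-1$ at $(q,p,a)$ and $0$ elsewhere; - if $c\Rightarrow^{T}c'$, and $[\![e]\!]_{\rho'}=v\in\mathbb{R}$ (respectively $T=0$), then $\mathsf{scale}(e,c)\Rightarrow^{vT}\mathsf{scale}(-1\Uparrow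 e,c')$ (respectively $\Rightarrow^{0}$); - $\mathsf{translate}(0,c)\Rightarrow^{T}c'$ if $c\Rightarrow^{T}c'$; $\mathsf{translate}(n+1,c)\Rightarrow^{0}\mathsf{translate}(n,c)$; - $\mathsf{both}(c_1,c_2)\Rightarrow^{T_1+T_2}\mathsf{both}(c_1',c_2')$ if $c_i\Rightarrow^{T_i}c_i'$; - $\mathsf{ifWithin}(e,n,c_1,c_2)\Rightarrow^{T}c_1'$ if $[\![e]\!]_{\rho'}=\mathsf{true}$ and $c_1\Rightarrow^{T}c_1'$; if $[\![e]\!]_{\rho'}=\mathsf{false}$, then $\mathsf{ifWithin}(e,0,c_1,c_2)\Rightarrow^{T}c_2'$ whenever $c_2\Rightarrow^{T}c_2'$, and $\mathsf{ifWithin}(e,n+1,c_1,c_2)\Rightarrow^{0}\mathsf{ifWithin}(e,n,c_1,c_2)$. An $n$-step reduction of $c$ at $\rho'$ is a chain of $n$ one-step reductions starting at $c$, the $k$-th of which ($k=0,\dots,n-1$) takes place at $\rho'/k$. **Payoff expressions** are built from $\mathsf{now}$, real, natural and boolean literals, template expressions, $\mathsf{model}(l,t)$, $\mathsf{if}$,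 $\mathsf{loopif}(il,il,il,t)$, $\mathsf{payoff}(t,p,q)$ and the unary and binary operators; template expressions may here contain sums and, inside $\mathsf{model}$, integer literals. Their partial semantics depends on $\rho$, $\delta$, a relative time $t_0\in\mathbb{N}$, the current time $t\in\mathbb{N}$, $d$, and two parties $p_1,p_2$, and takes values in $\mathbb{N}+\mathbb{R}+\mathbb{B}$: $\mathsf{now}$ is $t$; a template expression $u$ is $[\![u]\!]\delta+t_0$; $\mathsf{model}(l,u)$ is $\rho(l,[\![u]\!]\delta+t_0)$; $\mathsf{payoff}(u,q_1,q_2)$ is $d([\![u]\!]\delta+t_0)$ if $(q_1,q_2)=(p_1,p_2)$, otherwise $-d([\![u]\!]\delta+t_0)$ if $(q_1,q_2)=(p_2,p_1)$, otherwise $0$; $\mathsf{loopif}(il_0,il_1,il_2,u)$ evaluates $il_0$ at relative times $t_0,t_0+1,\dots,t_0+[\![u]\!]\delta$ and is $il_1$ at the first of these times at which $il_0$ is true, or $il_2$ at the last one if there is none; operators and $\mathsf{if}$ have their usual meaning (undefined on arguments of the wrong type; $<$ also compares naturals). Let $\mathrm{evalAt}_t(il,\rho,d)$ be the value of $il$ at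 relative time $t_0=0$ and current time $t$. **Compilation** with starting time $t_0$: $[\mathsf{obs}(l,i)]t_0=\mathsf{model}(l,t_0+i)$, $[\mathsf{cond}(b,e_0,e_1)]t_0=\mathsf{if}([b]t_0,[e_0]t_0,[e_1]t_0)$, literals and other operators homomorphically; $[\mathsf{zero}]t_0=0$, $[\mathsf{transfer}(p,q,a)]t_0=\mathsf{payoff}(t_0,p,q)$, $[\mathsf{scale}(e,c)]t_0=[e]t_0\cdot[c]t_0$, $[\mathsf{both}(c_1,c_2)]t_0=[c_1]t_0+[c_2]t_0$, $[\mathsf{translate}(u,c)]t_0=[c](t_0+u)$ (a sum of two numerals being computed), $[\mathsf{ifWithin}(e,u,c_1,c_2)]t_0=\mathsf{loopif}([e]t_0,[c_1]t_0,[c_2]t_0,u)$. The function $\mathrm{cutPayoff}$ replaces every subexpression $\mathsf{payoff}(u,p,q)$ by $\mathsf{if}(u<\mathsf{now},0,\mathsf{payoff}(u,p,q))$ and changes nothing else. **Theorem.** Let $\rho$ be a well-typed external environment extending a partial environment $\rho'$, $d:\mathbb{N}\to\mathbb{R}$, $p_1,p_2$ parties, $\delta$ any template environment, and $c$ a well-typed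 template-closed contract. 1. (One step.) If $c\Rightarrow^{T}_{\rho'}c'$, then $$\mathrm{evalAt}_1(\mathrm{cutPayoff}([c]0),\rho,d)=\mathrm{evalAt}_0([c']0,\rho/1,d/1),$$ both sides being defined and real. Moreover, if $\rho'$ is historically complete and $c$ is causally typed, there is exactly one pair $(T,c')$ with $c\Rightarrow^{T}_{\rho'}c'$; so reduction is then a total function. 2. ($n$ steps.) Let $n\in\mathbb{N}$. If $c$ reduces at $\rho'$ to $c'$ in $n$ steps, then $$\mathrm{evalAt}_n(\mathrm{cutPayoff}([c]0),\rho,d)=\mathrm{evalAt}_0([c']0,\rho/n,d/n),$$ both sides being defined and real. Moreover, if $\rho'/k$ is historically complete for every $k<n$ and $c$ is causally typed, there is exactly one such $c'$. -/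

import Mathlib

noncomputable section

namespace CL

/-! ## Values, environments -/

/-- The two types of contract expressions. -/
inductive Ty where
  | real
  | bool

/-- Values of contract expressions: the disjoint union of the reals and the booleans. -/
inductive Val where
  | real (r : ℝ)
  | bool (b : Bool)

/-- A value belongs to the interpretation of a type. -/
def Val.HasTy : Val → Ty → Prop
  | .real _, .real => True
  | .bool _, .bool => True
  | _, _ => False

/-- (Total) external environments; time indices are integers, negative ones are in the past. -/
abbrev ExtEnv (Label : Type*) := Label → ℤ → Val

/-- Partial external environments. -/
abbrev PExtEnv (Label : Type*) := Label → ℤ → Option Val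

/-- Template environments. -/
abbrev TEnv (TVar : Type*) := TVar → ℕ

/-- `ρ/n`: the external environment advanced by `n` time steps. -/
def ExtEnv.adv {Label : Type*} (ρ : ExtEnv Label) (n : ℕ) : ExtEnv Label :=
  fun l i => ρ l (i + n)

/-- `ρ'/n` for a partial external environment. -/
def PExtEnv.adv {Label : Type*} (ρ' : PExtEnv Label) (n : ℕ) : PExtEnv Label :=
  fun l i => ρ' l (i + n)

/-- `d/n`: the discount function advanced by `n` time steps. -/
def advDisc (d : ℕ → ℝ) (n : ℕ) : ℕ → ℝ := fun t => d (t + n)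

/-- Every label `l` carries a type `Λ l`; the environment respects it. -/
def ExtEnv.WellTyped {Label : Type*} (Λ : Label → Ty) (ρ : ExtEnv Label) : Prop :=
  ∀ l i, (ρ l i).HasTy (Λ l)

/-- The total environment `ρ` extends the partial environment `ρ'`. -/
def Extends {Label : Type*} (ρ : ExtEnv Label) (ρ' : PExtEnv Label) : Prop :=
  ∀ l i v, ρ' l i = some v → ρ l i = v

/-- All observables are known up to and including the present (time `0`). -/
def PExtEnv.HistoricallyComplete {Label : Type*} (ρ' : PExtEnv Label) : Prop :=
  ∀ l, ∀ i : ℤ, i ≤ 0 → ∃ v, ρ' l i = some v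

/-! ## The contract language -/

/-- Unary operators. -/
inductive UnOp where
  | neg
  | not

/-- Binary operators. -/
inductive BinOp where
  | add
  | sub
  | mult
  | div
  | lt
  | leq
  | eq
  | and
  | or

/-- Template expressions: numerals and template variables. -/
inductive TExpr (TVar : Type*) where
  | num (n : ℕ)
  | var (v : TVar)

def TExpr.eval {TVar : Type*} (δ : TEnv TVar) : TExpr TVar → ℕ
  | .num n => n
  | .var v => δ v

/-- Contract expressions. The operators `op(e₁, …, eₙ)` are grouped by their arity
(`cond` is the ternary one). -/
inductive Exp (Label : Type*) where
  | realLit (r : ℝ)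
  | boolLit (b : Bool)
  | obs (l : Label) (i : ℤ)
  | unop (op : UnOp) (e : Exp Label)
  | binop (op : BinOp) (e₁ e₂ : Exp Label)
  | cond (b e₁ e₂ : Exp Label)

/-- Contracts. -/
inductive Contr (Party Asset Label TVar : Type*) where
  | zero
  | transfer (p₁ p₂ : Party) (a : Asset)
  | scale (e : Exp Label) (c : Contr Party Asset Label TVar)
  | translate (t : TExpr TVar) (c : Contr Party Asset Label TVar)
  | both (c₁ c₂ : Contr Party Asset Label TVar)
  | ifWithin (e : Exp Label) (t : TExpr TVar) (c₁ c₂ : Contr Party Asset Label TVar)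

/-! ### Typing -/

/-- The type of the argument of a unary operator, which is also that of its result. -/
def UnOp.ty : UnOp → Ty
  | .neg => .real
  | .not => .bool

/-- The common type of both arguments of a binary operator. -/
def BinOp.argTy : BinOp → Ty
  | .and | .or => .bool
  | _ => .real

/-- The type of the result of a binary operator. -/
def BinOp.resTy : BinOp → Ty
  | .add | .sub | .mult | .div => .real
  | _ => .bool

/-- The typing judgement `⊢ e : τ`. -/
inductive Exp.HasTy {Label : Type*} (Λ : Label → Ty) : Exp Label → Ty → Prop
  | realLit (r : ℝ) : HasTy Λ (.realLit r) .real
  | boolLit (b : Bool) : HasTy Λ (.boolLit b) .bool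
  | obs (l : Label) (i : ℤ) : HasTy Λ (.obs l i) (Λ l)
  | unop {op : UnOp} {e : Exp Label} : HasTy Λ e op.ty → HasTy Λ (.unop op e) op.ty
  | binop {op : BinOp} {e₁ e₂ : Exp Label} :
      HasTy Λ e₁ op.argTy → HasTy Λ e₂ op.argTy → HasTy Λ (.binop op e₁ e₂) op.resTy
  | cond {b e₁ e₂ : Exp Label} {τ : Ty} :
      HasTy Λ b .bool → HasTy Λ e₁ τ → HasTy Λ e₂ τ → HasTy Λ (.cond b e₁ e₂) τ

/-- The typing judgement `⊢ c` for contracts. -/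
inductive Contr.WellTyped {Party Asset Label TVar : Type*} (Λ : Label → Ty) :
    Contr Party Asset Label TVar → Prop
  | zero : WellTyped Λ .zero
  | transfer (p₁ p₂ : Party) (a : Asset) : WellTyped Λ (.transfer p₁ p₂ a)
  | scale {e : Exp Label} {c : Contr Party Asset Label TVar} :
      e.HasTy Λ .real → WellTyped Λ c → WellTyped Λ (.scale e c)
  | translate {t : TExpr TVar} {c : Contr Party Asset Label TVar} :
      WellTyped Λ c → WellTyped Λ (.translate t c)
  | both {c₁ c₂ : Contr Party Asset Label TVar} :
      WellTyped Λ c₁ → WellTyped Λ c₂ → WellTyped Λ (.both c₁ c₂)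
  | ifWithin {e : Exp Label} {t : TExpr TVar} {c₁ c₂ : Contr Party Asset Label TVar} :
      e.HasTy Λ .bool → WellTyped Λ c₁ → WellTyped Λ c₂ → WellTyped Λ (.ifWithin e t c₁ c₂)

/-- The time-indexed judgement `⊢ e : τ^t`: `e` has type `τ` and its value is known at time `t`. -/
inductive Exp.HasTyAt {Label : Type*} (Λ : Label → Ty) : Exp Label → Ty → ℤ → Prop
  | realLit (r : ℝ) (t : ℤ) : HasTyAt Λ (.realLit r) .real t
  | boolLit (b : Bool) (t : ℤ) : HasTyAt Λ (.boolLit b) .bool t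
  | obs (l : Label) {i t : ℤ} : i ≤ t → HasTyAt Λ (.obs l i) (Λ l) t
  | unop {op : UnOp} {e : Exp Label} {t : ℤ} :
      HasTyAt Λ e op.ty t → HasTyAt Λ (.unop op e) op.ty t
  | binop {op : BinOp} {e₁ e₂ : Exp Label} {t : ℤ} :
      HasTyAt Λ e₁ op.argTy t → HasTyAt Λ e₂ op.argTy t → HasTyAt Λ (.binop op e₁ e₂) op.resTy t
  | cond {b e₁ e₂ : Exp Label} {τ : Ty} {t : ℤ} :
      HasTyAt Λ b .bool t → HasTyAt Λ e₁ τ t → HasTyAt Λ e₂ τ t → HasTyAt Λ (.cond b e₁ e₂) τ t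

/-- The time-indexed (causality) judgement `⊢ c : Contr^t`: `c` is causal and prescribes no
transfers strictly before time `t`. -/
inductive Contr.HasTyAt {Party Asset Label TVar : Type*} (Λ : Label → Ty) (δ : TEnv TVar) :
    Contr Party Asset Label TVar → ℤ → Prop
  | zero (t : ℤ) : HasTyAt Λ δ .zero t
  | transfer (p₁ p₂ : Party) (a : Asset) {t : ℤ} : t ≤ 0 → HasTyAt Λ δ (.transfer p₁ p₂ a) t
  | scale {e : Exp Label} {c : Contr Party Asset Label TVar} {s t : ℤ} :
      e.HasTyAt Λ .real s → HasTyAt Λ δ c s → t ≤ s → HasTyAt Λ δ (.scale e c) t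
  | translate {te : TExpr TVar} {c : Contr Party Asset Label TVar} {t : ℤ} :
      HasTyAt Λ δ c t → HasTyAt Λ δ (.translate te c) (t + te.eval δ)
  | both {c₁ c₂ : Contr Party Asset Label TVar} {t : ℤ} :
      HasTyAt Λ δ c₁ t → HasTyAt Λ δ c₂ t → HasTyAt Λ δ (.both c₁ c₂) t
  | ifWithin {e : Exp Label} {te : TExpr TVar} {c₁ c₂ : Contr Party Asset Label TVar} {t : ℤ} :
      e.HasTyAt Λ .bool 0 → HasTyAt Λ δ c₁ t → HasTyAt Λ δ c₂ (t - te.eval δ) →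
      HasTyAt Λ δ (.ifWithin e te c₁ c₂) t

/-- Template-closed contracts: no template variables occur. -/
inductive Contr.TemplateClosed {Party Asset Label TVar : Type*} :
    Contr Party Asset Label TVar → Prop
  | zero : TemplateClosed .zero
  | transfer (p₁ p₂ : Party) (a : Asset) : TemplateClosed (.transfer p₁ p₂ a)
  | scale {e : Exp Label} {c : Contr Party Asset Label TVar} :
      TemplateClosed c → TemplateClosed (.scale e c)
  | translate (n : ℕ) {c : Contr Party Asset Label TVar} :
      TemplateClosed c → TemplateClosed (.translate (.num n) c)
  | both {c₁ c₂ : Contr Party Asset Label TVar} :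
      TemplateClosed c₁ → TemplateClosed c₂ → TemplateClosed (.both c₁ c₂)
  | ifWithin {e : Exp Label} (n : ℕ) {c₁ c₂ : Contr Party Asset Label TVar} :
      TemplateClosed c₁ → TemplateClosed c₂ → TemplateClosed (.ifWithin e (.num n) c₁ c₂)

/-! ### Expression semantics -/

def UnOp.sem : UnOp → Val → Option Val
  | .neg, .real x => some (.real (-x))
  | .not, .bool a => some (.bool (!a))
  | _, _ => none

def BinOp.sem : BinOp → Val → Val → Option Val
  | .add, .real x, .real y => some (.real (x + y))
  | .sub, .real x, .real y => some (.real (x - y))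
  | .mult, .real x, .real y => some (.real (x * y))
  | .div, .real x, .real y => some (.real (x / y))
  | .lt, .real x, .real y => some (.bool (decide (x < y)))
  | .leq, .real x, .real y => some (.bool (decide (x ≤ y)))
  | .eq, .real x, .real y => some (.bool (decide (x = y)))
  | .and, .bool a, .bool b => some (.bool (a && b))
  | .or, .bool a, .bool b => some (.bool (a || b))
  | _, _, _ => none

def condSem : Val → Val → Val → Option Val
  | .bool b, .real x, .real y => some (.real (if b then x else y))
  | .bool b, .bool x, .bool y => some (.bool (if b then x else y))
  | _, _, _ => none

/-- The (strict, partial) semantics of expressions in a partial external environment. -/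
def Exp.eval {Label : Type*} (ρ' : PExtEnv Label) : Exp Label → Option Val
  | .realLit r => some (.real r)
  | .boolLit b => some (.bool b)
  | .obs l i => ρ' l i
  | .unop op e => (e.eval ρ').bind op.sem
  | .binop op e₁ e₂ => (e₁.eval ρ').bind fun v₁ => (e₂.eval ρ').bind fun v₂ => op.sem v₁ v₂
  | .cond b e₁ e₂ =>
      (b.eval ρ').bind fun v => (e₁.eval ρ').bind fun v₁ => (e₂.eval ρ').bind fun v₂ =>
        condSem v v₁ v₂

/-- The promotion `k ⇑ e`: all observables of `e` are shifted by `k` time units. -/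
def Exp.promote {Label : Type*} (k : ℤ) : Exp Label → Exp Label
  | .realLit r => .realLit r
  | .boolLit b => .boolLit b
  | .obs l i => .obs l (i + k)
  | .unop op e => .unop op (e.promote k)
  | .binop op e₁ e₂ => .binop op (e₁.promote k) (e₂.promote k)
  | .cond b e₁ e₂ => .cond (b.promote k) (e₁.promote k) (e₂.promote k)

/-! ### Contract reduction -/

/-- Net transfers between parties on a single day. -/
abbrev Trans (Party Asset : Type*) := Party → Party → Asset → ℝ

/-- One unit of `a` is transferred from `p₁` to `p₂`. -/
def unitTrans {Party Asset : Type*} [DecidableEq Party] [DecidableEq Asset]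
    (p₁ p₂ : Party) (a : Asset) : Trans Party Asset := fun q₁ q₂ b =>
  if p₁ = p₂ then 0
  else if q₁ = p₁ ∧ q₂ = p₂ ∧ b = a then 1
  else if q₁ = p₂ ∧ q₂ = p₁ ∧ b = a then -1
  else 0

/-- `Red ρ' c T c'`: knowing the observables recorded in `ρ'`, the contract `c` evolves in one
time step to `c'`, and prescribes the transfers `T` on the way. It is defined on contracts
without template variables. -/
inductive Red {Party Asset Label TVar : Type*} [DecidableEq Party] [DecidableEq Asset]
    (ρ' : PExtEnv Label) :
    Contr Party Asset Label TVar → Trans Party Asset → Contr Party Asset Label TVar → Prop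
  | zero : Red ρ' .zero 0 .zero
  | transfer (p₁ p₂ : Party) (a : Asset) : Red ρ' (.transfer p₁ p₂ a) (unitTrans p₁ p₂ a) .zero
  | scale {e : Exp Label} {v : ℝ} {c c' : Contr Party Asset Label TVar} {T : Trans Party Asset} :
      e.eval ρ' = some (.real v) → Red ρ' c T c' →
      Red ρ' (.scale e c) (v • T) (.scale (e.promote (-1)) c')
  | scaleZero {e : Exp Label} {c c' : Contr Party Asset Label TVar} :
      Red ρ' c 0 c' → Red ρ' (.scale e c) 0 (.scale (e.promote (-1)) c')
  | translateZero {c c' : Contr Party Asset Label TVar} {T : Trans Party Asset} :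
      Red ρ' c T c' → Red ρ' (.translate (.num 0) c) T c'
  | translateSucc (n : ℕ) (c : Contr Party Asset Label TVar) :
      Red ρ' (.translate (.num (n + 1)) c) 0 (.translate (.num n) c)
  | both {c₁ c₂ c₁' c₂' : Contr Party Asset Label TVar} {T₁ T₂ : Trans Party Asset} :
      Red ρ' c₁ T₁ c₁' → Red ρ' c₂ T₂ c₂' → Red ρ' (.both c₁ c₂) (T₁ + T₂) (.both c₁' c₂')
  | ifTrue {e : Exp Label} (n : ℕ) {c₁ c₂ c₁' : Contr Party Asset Label TVar}
      {T : Trans Party Asset} :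
      e.eval ρ' = some (.bool true) → Red ρ' c₁ T c₁' → Red ρ' (.ifWithin e (.num n) c₁ c₂) T c₁'
  | ifFalseZero {e : Exp Label} {c₁ c₂ c₂' : Contr Party Asset Label TVar}
      {T : Trans Party Asset} :
      e.eval ρ' = some (.bool false) → Red ρ' c₂ T c₂' → Red ρ' (.ifWithin e (.num 0) c₁ c₂) T c₂'
  | ifFalseSucc {e : Exp Label} (n : ℕ) {c₁ c₂ : Contr Party Asset Label TVar} :
      e.eval ρ' = some (.bool false) →
      Red ρ' (.ifWithin e (.num (n + 1)) c₁ c₂) 0 (.ifWithin e (.num n) c₁ c₂)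

/-- `RedN ρ' n c c'`: the contract `c` evolves to `c'` in `n` time steps, where step
`k = 0, …, n - 1` takes place in the environment `ρ'/k`. -/
inductive RedN {Party Asset Label TVar : Type*} [DecidableEq Party] [DecidableEq Asset] :
    PExtEnv Label → ℕ → Contr Party Asset Label TVar → Contr Party Asset Label TVar → Prop
  | refl (ρ' : PExtEnv Label) (c : Contr Party Asset Label TVar) : RedN ρ' 0 c c
  | step {ρ' : PExtEnv Label} {n : ℕ} {c c₁ c' : Contr Party Asset Label TVar}
      {T : Trans Party Asset} :
      Red ρ' c T c₁ → RedN (ρ'.adv 1) n c₁ c' → RedN ρ' (n + 1) c c'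

/-! ## The payoff language -/

/-- Template expressions with addition (natural-number valued). -/
inductive ILTExpr (TVar : Type*) where
  | tplus (t₁ t₂ : ILTExpr TVar)
  | texpr (t : TExpr TVar)

/-- Template expressions with integer literals and addition (integer valued). -/
inductive ILTExprZ (TVar : Type*) where
  | tplus (t₁ t₂ : ILTExprZ TVar)
  | iltexpr (t : ILTExpr TVar)
  | num (z : ℤ)

def ILTExpr.eval {TVar : Type*} (δ : TEnv TVar) : ILTExpr TVar → ℕ
  | .tplus t₁ t₂ => t₁.eval δ + t₂.eval δ
  | .texpr t => t.eval δ

def ILTExprZ.eval {TVar : Type*} (δ : TEnv TVar) : ILTExprZ TVar → ℤ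
  | .tplus t₁ t₂ => t₁.eval δ + t₂.eval δ
  | .iltexpr t => (t.eval δ : ℤ)
  | .num z => z

/-- Payoff expressions. -/
inductive ILExpr (Party Label TVar : Type*) where
  | now
  | real (r : ℝ)
  | nat (n : ℕ)
  | bool (b : Bool)
  | texpr (t : ILTExpr TVar)
  | model (l : Label) (t : ILTExprZ TVar)
  | ite (b il₁ il₂ : ILExpr Party Label TVar)
  | loopif (b il₁ il₂ : ILExpr Party Label TVar) (t : TExpr TVar)
  | payoff (t : ILTExpr TVar) (p₁ p₂ : Party)
  | unop (op : UnOp) (il : ILExpr Party Label TVar)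
  | binop (op : BinOp) (il₁ il₂ : ILExpr Party Label TVar)

/-- Values of payoff expressions. -/
inductive ILVal where
  | nat (n : ℕ)
  | real (r : ℝ)
  | bool (b : Bool)

def Val.toIL : Val → ILVal
  | .real r => .real r
  | .bool b => .bool b

def UnOp.ilSem : UnOp → ILVal → Option ILVal
  | .neg, .real x => some (.real (-x))
  | .not, .bool a => some (.bool (!a))
  | _, _ => none

def BinOp.ilSem : BinOp → ILVal → ILVal → Option ILVal
  | .add, .real x, .real y => some (.real (x + y))
  | .sub, .real x, .real y => some (.real (x - y))
  | .mult, .real x, .real y => some (.real (x * y))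
  | .div, .real x, .real y => some (.real (x / y))
  | .lt, .real x, .real y => some (.bool (decide (x < y)))
  | .lt, .nat m, .nat n => some (.bool (decide (m < n)))
  | .leq, .real x, .real y => some (.bool (decide (x ≤ y)))
  | .eq, .real x, .real y => some (.bool (decide (x = y)))
  | .and, .bool a, .bool b => some (.bool (a && b))
  | .or, .bool a, .bool b => some (.bool (a || b))
  | _, _, _ => none

/-- `iteSem v w₁ w₂` is `w₁` or `w₂` according to the boolean `v`, and undefined if `v` is not
a boolean. -/
def iteSem (v w₁ w₂ : Option ILVal) : Option ILVal :=
  match v with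
  | some (.bool true) => w₁
  | some (.bool false) => w₂
  | _ => none

/-- The iteration in the semantics of `loopif`: the condition `b` is checked at the times
`t₀, …, t₀ + n`; as soon as it is true, `f` is taken at that time; if it never is, `g` is taken
at time `t₀ + n`. -/
def loopSem (b f g : ℕ → Option ILVal) : ℕ → ℕ → Option ILVal
  | 0, t₀ => iteSem (b t₀) (f t₀) (g t₀)
  | n + 1, t₀ => iteSem (b t₀) (f t₀) (loopSem b f g n (t₀ + 1))

/-- The partial semantics of payoff expressions; the last two arguments are the relative time
shift `t₀` and the current time `t`. -/
def ILExpr.sem {Party Label TVar : Type*} [DecidableEq Party] (ρ : ExtEnv Label) (δ : TEnv TVar)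
    (d : ℕ → ℝ) (p₁ p₂ : Party) : ILExpr Party Label TVar → ℕ → ℕ → Option ILVal
  | .now, _, t => some (.nat t)
  | .real r, _, _ => some (.real r)
  | .nat n, _, _ => some (.nat n)
  | .bool b, _, _ => some (.bool b)
  | .texpr te, t₀, _ => some (.nat (te.eval δ + t₀))
  | .model l te, t₀, _ => some (ρ l (te.eval δ + t₀)).toIL
  | .ite b il₁ il₂, t₀, t =>
      iteSem (b.sem ρ δ d p₁ p₂ t₀ t) (il₁.sem ρ δ d p₁ p₂ t₀ t) (il₂.sem ρ δ d p₁ p₂ t₀ t)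
  | .loopif b il₁ il₂ te, t₀, t =>
      loopSem (fun s => b.sem ρ δ d p₁ p₂ s t) (fun s => il₁.sem ρ δ d p₁ p₂ s t)
        (fun s => il₂.sem ρ δ d p₁ p₂ s t) (te.eval δ) t₀
  | .payoff te q₁ q₂, t₀, _ =>
      some (.real (if q₁ = p₁ ∧ q₂ = p₂ then d (te.eval δ + t₀)
        else if q₁ = p₂ ∧ q₂ = p₁ then -d (te.eval δ + t₀)
        else 0))
  | .unop op il, t₀, t => (il.sem ρ δ d p₁ p₂ t₀ t).bind op.ilSem
  | .binop op il₁ il₂, t₀, t =>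
      (il₁.sem ρ δ d p₁ p₂ t₀ t).bind fun v₁ => (il₂.sem ρ δ d p₁ p₂ t₀ t).bind fun v₂ =>
        op.ilSem v₁ v₂

/-- Evaluation of a payoff expression at current time `t`. -/
def evalAt {Party Label TVar : Type*} [DecidableEq Party] (δ : TEnv TVar) (p₁ p₂ : Party) (t : ℕ)
    (il : ILExpr Party Label TVar) (ρ : ExtEnv Label) (d : ℕ → ℝ) : Option ILVal :=
  il.sem ρ δ d p₁ p₂ 0 t

/-! ## Compilation -/

/-- The smart constructor for addition: numerals are added, otherwise the sum is syntactic. -/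
def smartTplus {TVar : Type*} : ILTExpr TVar → ILTExpr TVar → ILTExpr TVar
  | .texpr (.num m), .texpr (.num n) => .texpr (.num (m + n))
  | t₁, t₂ => .tplus t₁ t₂

/-- Compilation of expressions, with starting time `t₀`. -/
def Exp.compile {Party Label TVar : Type*} (t₀ : ILTExprZ TVar) :
    Exp Label → ILExpr Party Label TVar
  | .realLit r => .real r
  | .boolLit b => .bool b
  | .obs l i => .model l (.tplus t₀ (.num i))
  | .unop op e => .unop op (e.compile t₀)
  | .binop op e₁ e₂ => .binop op (e₁.compile t₀) (e₂.compile t₀)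
  | .cond b e₁ e₂ => .ite (b.compile t₀) (e₁.compile t₀) (e₂.compile t₀)

/-- Compilation of contracts, with starting time `t₀`. -/
def Contr.compile {Party Asset Label TVar : Type*} :
    Contr Party Asset Label TVar → ILTExpr TVar → ILExpr Party Label TVar
  | .zero, _ => .real 0
  | .transfer p₁ p₂ _, t₀ => .payoff t₀ p₁ p₂
  | .scale e c, t₀ => .binop .mult (e.compile (.iltexpr t₀)) (c.compile t₀)
  | .translate t c, t₀ => c.compile (smartTplus t₀ (.texpr t))
  | .both c₁ c₂, t₀ => .binop .add (c₁.compile t₀) (c₂.compile t₀)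
  | .ifWithin e t c₁ c₂, t₀ =>
      .loopif (e.compile (.iltexpr t₀)) (c₁.compile t₀) (c₂.compile t₀) t

/-- Compilation of contracts with starting time `0`. -/
def Contr.compile₀ {Party Asset Label TVar : Type*} (c : Contr Party Asset Label TVar) :
    ILExpr Party Label TVar :=
  c.compile (.texpr (.num 0))

/-- `cutPayoff` guards every payoff so that it does not count if it lies before the current
time. -/
def cutPayoff {Party Label TVar : Type*} : ILExpr Party Label TVar → ILExpr Party Label TVar
  | .now => .now
  | .real r => .real r
  | .nat n => .nat n
  | .bool b => .bool b
  | .texpr t => .texpr t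
  | .model l t => .model l t
  | .ite b il₁ il₂ => .ite (cutPayoff b) (cutPayoff il₁) (cutPayoff il₂)
  | .loopif b il₁ il₂ t => .loopif (cutPayoff b) (cutPayoff il₁) (cutPayoff il₂) t
  | .payoff t p₁ p₂ => .ite (.binop .lt (.texpr t) .now) (.real 0) (.payoff t p₁ p₂)
  | .unop op il => .unop op (cutPayoff il)
  | .binop op il₁ il₂ => .binop op (cutPayoff il₁) (cutPayoff il₂)

end CL

end

namespace CL

section

variable {Party Asset Label TVar : Type*}

/-! ### Environments -/

/-! The core is `Red.evalAt_eq`: one reduction step turns current time `t + 1` under `ρ`, `d` into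
current time `t` under `ρ/1`, `d/1`. Keeping `cutPayoff` on both sides and `t` arbitrary lets this
invariant be chained along `n` steps. At current time `0` no guard fires, so the remaining cut
disappears (`sem_cutPayoff_zero`).

The invariant is an equality of partial values, proved by induction on the reduction. Today's
transfers are cut at every current time `t + 1`, so `T` plays no role. The promotion by `-1` under
`scale` cancels the advance of the environment (`Exp.sem_compile_promote`). A contract that merely
waits is handled by moving its starting time (`Contr.sem_shift`). Conditions already decided in `ρ'`
keep their value in `ρ`.

Definedness is a separate matter: a well-typed contract compiles to a real value in any well-typed
total environment (`Contr.WellTyped.exists_sem`).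

Reductions exist by causality (`Contr.HasTyAt.exists_red`). The only delicate case is a scaling
factor not yet known: the scaled contract then has a positive time index, transfers nothing today,
and `scaleZero` applies. Uniqueness holds because the two overlapping rules for `scale` agree. -/

theorem ExtEnv.adv_zero (ρ : ExtEnv Label) : ρ.adv 0 = ρ := by
  funext l i; simp [ExtEnv.adv]

theorem ExtEnv.adv_adv (ρ : ExtEnv Label) (m n : ℕ) : (ρ.adv m).adv n = ρ.adv (n + m) := by
  funext l i; simp [ExtEnv.adv, add_assoc]

theorem PExtEnv.adv_zero (ρ' : PExtEnv Label) : ρ'.adv 0 = ρ' := by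
  funext l i; simp [PExtEnv.adv]

theorem PExtEnv.adv_adv (ρ' : PExtEnv Label) (m n : ℕ) : (ρ'.adv m).adv n = ρ'.adv (n + m) := by
  funext l i; simp [PExtEnv.adv, add_assoc]

theorem advDisc_zero (d : ℕ → ℝ) : advDisc d 0 = d := rfl

theorem advDisc_advDisc (d : ℕ → ℝ) (m n : ℕ) :
    advDisc (advDisc d m) n = advDisc d (n + m) := by
  funext t; simp [advDisc, add_assoc]

theorem ExtEnv.WellTyped.adv {Λ : Label → Ty} {ρ : ExtEnv Label} (h : ρ.WellTyped Λ) (n : ℕ) :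
    (ρ.adv n).WellTyped Λ :=
  fun l i => h l (i + n)

theorem Extends.adv {ρ : ExtEnv Label} {ρ' : PExtEnv Label} (h : Extends ρ ρ') (n : ℕ) :
    Extends (ρ.adv n) (ρ'.adv n) :=
  fun l i v => h l (i + n) v

/-! ### Operators on typed values. -/

theorem Val.HasTy.exists_real {v : Val} (h : v.HasTy .real) : ∃ r, v = .real r := by
  cases v <;> simp_all [Val.HasTy]

theorem Val.HasTy.exists_bool {v : Val} (h : v.HasTy .bool) : ∃ b, v = .bool b := by
  cases v <;> simp_all [Val.HasTy]

theorem UnOp.sem_hasTy {op : UnOp} {v : Val} (h : v.HasTy op.ty) :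
    ∃ w, op.sem v = some w ∧ w.HasTy op.ty := by
  cases op <;> cases v <;> simp_all [Val.HasTy, UnOp.ty, UnOp.sem]

/-- Typed arguments never make an operator undefined; division is included because `x / 0 = 0` in
`ℝ`. -/
theorem BinOp.sem_hasTy {op : BinOp} {v₁ v₂ : Val} (h₁ : v₁.HasTy op.argTy)
    (h₂ : v₂.HasTy op.argTy) : ∃ w, op.sem v₁ v₂ = some w ∧ w.HasTy op.resTy := by
  cases op <;> cases v₁ <;> cases v₂ <;>
    simp_all [Val.HasTy, BinOp.argTy, BinOp.resTy, BinOp.sem]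

theorem condSem_hasTy {τ : Ty} {v v₁ v₂ : Val} (h : v.HasTy .bool) (h₁ : v₁.HasTy τ)
    (h₂ : v₂.HasTy τ) : ∃ w, condSem v v₁ v₂ = some w ∧ w.HasTy τ := by
  cases τ <;> cases v <;> cases v₁ <;> cases v₂ <;> simp_all [Val.HasTy, condSem]

theorem UnOp.ilSem_toIL {op : UnOp} {v w : Val} (h : op.sem v = some w) :
    op.ilSem v.toIL = some w.toIL := by
  cases op <;> cases v <;> simp_all [UnOp.sem, UnOp.ilSem, Val.toIL] <;> subst h <;> rfl

theorem BinOp.ilSem_toIL {op : BinOp} {v₁ v₂ w : Val} (h : op.sem v₁ v₂ = some w) :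
    op.ilSem v₁.toIL v₂.toIL = some w.toIL := by
  cases op <;> cases v₁ <;> cases v₂ <;> simp_all [BinOp.sem, BinOp.ilSem, Val.toIL] <;>
    subst h <;> rfl

/-- Only this implication holds: `condSem` rejects branches of different types, whereas `iteSem`
looks at the chosen branch alone. -/
theorem iteSem_toIL {v v₁ v₂ w : Val} (h : condSem v v₁ v₂ = some w) :
    iteSem (some v.toIL) (some v₁.toIL) (some v₂.toIL) = some w.toIL := by
  rcases v with _ | _ | _ <;> cases v₁ <;> cases v₂ <;>
    simp_all [condSem, iteSem, Val.toIL] <;> subst h <;> rfl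

/-! ### Expressions -/

/-- Expressions typed at time `t` have a value in partial environments defined up to time `t`. -/
theorem Exp.HasTyAt.exists_eval {Λ : Label → Ty} {ρ : ExtEnv Label} (hρ : ρ.WellTyped Λ)
    {ρ' : PExtEnv Label} (hext : Extends ρ ρ') {e : Exp Label} {τ : Ty} {t : ℤ}
    (he : e.HasTyAt Λ τ t) (hc : ∀ l, ∀ i ≤ t, ∃ v, ρ' l i = some v) :
    ∃ v, e.eval ρ' = some v ∧ v.HasTy τ := by
  induction he with
  | realLit r t => exact ⟨_, rfl, trivial⟩
  | boolLit b t => exact ⟨_, rfl, trivial⟩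
  | @obs l i t hi =>
    obtain ⟨v, hv⟩ := hc l i hi
    exact ⟨v, hv, hext l i v hv ▸ hρ l i⟩
  | unop _ ih =>
    obtain ⟨v, hv, hv'⟩ := ih hc
    obtain ⟨w, hw, hw'⟩ := UnOp.sem_hasTy hv'
    exact ⟨w, by simp [Exp.eval, hv, hw], hw'⟩
  | binop _ _ ih₁ ih₂ =>
    obtain ⟨v₁, hv₁, hv₁'⟩ := ih₁ hc
    obtain ⟨v₂, hv₂, hv₂'⟩ := ih₂ hc
    obtain ⟨w, hw, hw'⟩ := BinOp.sem_hasTy hv₁' hv₂'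
    exact ⟨w, by simp [Exp.eval, hv₁, hv₂, hw], hw'⟩
  | cond _ _ _ ih ih₁ ih₂ =>
    obtain ⟨v, hv, hv'⟩ := ih hc
    obtain ⟨v₁, hv₁, hv₁'⟩ := ih₁ hc
    obtain ⟨v₂, hv₂, hv₂'⟩ := ih₂ hc
    obtain ⟨w, hw, hw'⟩ := condSem_hasTy hv' hv₁' hv₂'
    exact ⟨w, by simp [Exp.eval, hv, hv₁, hv₂, hw], hw'⟩

theorem Exp.promote_zero (e : Exp Label) : e.promote 0 = e := by
  induction e <;> simp_all [Exp.promote]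

theorem Exp.HasTyAt.promote {Λ : Label → Ty} {e : Exp Label} {τ : Ty} {t : ℤ}
    (h : e.HasTyAt Λ τ t) (k : ℤ) : (e.promote k).HasTyAt Λ τ (t + k) := by
  induction h with
  | realLit r t => exact .realLit r _
  | boolLit b t => exact .boolLit b _
  | obs l hi => exact .obs l (by lia)
  | unop _ ih => exact .unop ih
  | binop _ _ ih₁ ih₂ => exact .binop ih₁ ih₂
  | cond _ _ _ ih ih₁ ih₂ => exact .cond ih ih₁ ih₂

/-- Compiled expressions contain no `payoff`, hence nothing to guard. -/
theorem cutPayoff_compile_exp (e : Exp Label) (t₀ : ILTExprZ TVar) :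
    cutPayoff (e.compile t₀ : ILExpr Party Label TVar) = e.compile t₀ := by
  induction e <;> simp_all [Exp.compile, cutPayoff]

section Semantics

variable [DecidableEq Party] {Λ : Label → Ty} {ρ : ExtEnv Label} {ρ' : PExtEnv Label}
  {δ : TEnv TVar} {d : ℕ → ℝ} {p₁ p₂ : Party}

/-- Compiled expressions denote the value of the expression, at the time at which they start. -/
theorem Exp.sem_compile_of_eval {e : Exp Label} {t₀ : ILTExprZ TVar} {s : ℕ}
    (hext : ∀ l i v, ρ' l i = some v → ρ l (t₀.eval δ + i + s) = v) {v : Val}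
    (h : e.eval ρ' = some v) (t : ℕ) :
    (e.compile t₀ : ILExpr Party Label TVar).sem ρ δ d p₁ p₂ s t = some v.toIL := by
  induction e generalizing v with
  | realLit r => simp only [Exp.eval, Option.some.injEq] at h; subst h; rfl
  | boolLit b => simp only [Exp.eval, Option.some.injEq] at h; subst h; rfl
  | obs l i => simp [Exp.compile, ILExpr.sem, ILTExprZ.eval, hext l i v h]
  | unop op e ih =>
    simp only [Exp.eval, Option.bind_eq_some_iff] at h
    obtain ⟨w, hw, h⟩ := h
    simp [Exp.compile, ILExpr.sem, ih hw, UnOp.ilSem_toIL h]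
  | binop op e₁ e₂ ih₁ ih₂ =>
    simp only [Exp.eval, Option.bind_eq_some_iff] at h
    obtain ⟨w₁, hw₁, w₂, hw₂, h⟩ := h
    simp [Exp.compile, ILExpr.sem, ih₁ hw₁, ih₂ hw₂, BinOp.ilSem_toIL h]
  | cond b e₁ e₂ ih ih₁ ih₂ =>
    simp only [Exp.eval, Option.bind_eq_some_iff] at h
    obtain ⟨w, hw, w₁, hw₁, w₂, hw₂, h⟩ := h
    simp [Exp.compile, ILExpr.sem, ih hw, ih₁ hw₁, ih₂ hw₂, iteSem_toIL h]

/-- An expression mentions finitely many observables, so their indices are bounded. Asking for all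
later times lets the bounds of subexpressions be combined by `max`. -/
theorem Exp.HasTy.hasTyAt {e : Exp Label} {τ : Ty} (he : e.HasTy Λ τ) :
    ∃ t₀, ∀ t ≥ t₀, e.HasTyAt Λ τ t := by
  induction he with
  | realLit r => exact ⟨0, fun t _ => .realLit r t⟩
  | boolLit b => exact ⟨0, fun t _ => .boolLit b t⟩
  | obs l i => exact ⟨i, fun t ht => .obs l ht⟩
  | unop _ ih =>
    obtain ⟨t₀, h⟩ := ih
    exact ⟨t₀, fun t ht => .unop (h t ht)⟩
  | binop _ _ ih₁ ih₂ =>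
    obtain ⟨t₁, h₁⟩ := ih₁
    obtain ⟨t₂, h₂⟩ := ih₂
    exact ⟨max t₁ t₂, fun t ht => .binop (h₁ t (by lia)) (h₂ t (by lia))⟩
  | cond _ _ _ ih ih₁ ih₂ =>
    obtain ⟨t₀, h⟩ := ih
    obtain ⟨t₁, h₁⟩ := ih₁
    obtain ⟨t₂, h₂⟩ := ih₂
    exact ⟨max t₀ (max t₁ t₂),
      fun t ht => .cond (h t (by lia)) (h₁ t (by lia)) (h₂ t (by lia))⟩

/-- Compiled well-typed expressions have a value of the right type. -/
theorem Exp.HasTy.exists_sem_compile {e : Exp Label} {τ : Ty} (he : e.HasTy Λ τ)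
    (hρ : ρ.WellTyped Λ) (t₀ : ILTExprZ TVar) (s t : ℕ) :
    ∃ v : Val, v.HasTy τ ∧
      (e.compile t₀ : ILExpr Party Label TVar).sem ρ δ d p₁ p₂ s t = some v.toIL := by
  -- `σ` is `ρ` as seen from the starting time. Read as a partial environment it is defined
  -- everywhere, so the causal existence lemma applies at any bound on the indices.
  let σ : ExtEnv Label := fun l i => ρ l (t₀.eval δ + i + s)
  obtain ⟨u, hu⟩ := he.hasTyAt
  obtain ⟨v, hv, hv'⟩ := (hu u le_rfl).exists_eval (ρ := σ) (ρ' := fun l i => some (σ l i))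
    (fun l i => hρ l _) (fun l i v h => Option.some.inj h) (fun l i _ => ⟨_, rfl⟩)
  exact ⟨v, hv', sem_compile_of_eval (fun l i v h => Option.some.inj h) hv t⟩

/-- Promoting an expression, moving its starting time and advancing the environment cancel when
the shifts add up. -/
theorem Exp.sem_compile_promote (e : Exp Label) {t₀ t₀' : ILTExprZ TVar} {s s' k : ℕ} {j : ℤ}
    (h : t₀.eval δ + s = t₀'.eval δ + s' + j + k) (d d' : ℕ → ℝ) (t t' : ℕ) :
    (e.compile t₀ : ILExpr Party Label TVar).sem ρ δ d p₁ p₂ s t =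
      ((e.promote j).compile t₀').sem (ρ.adv k) δ d' p₁ p₂ s' t' := by
  induction e with
  | realLit r => rfl
  | boolLit b => rfl
  | obs l i =>
    simp only [Exp.compile, Exp.promote, ILExpr.sem, ILTExprZ.eval, ExtEnv.adv]
    congr 3
    lia
  | unop op e ih => simp only [Exp.compile, Exp.promote, ILExpr.sem, ih]
  | binop op e₁ e₂ ih₁ ih₂ => simp only [Exp.compile, Exp.promote, ILExpr.sem, ih₁, ih₂]
  | cond b e₁ e₂ ih ih₁ ih₂ => simp only [Exp.compile, Exp.promote, ILExpr.sem, ih, ih₁, ih₂]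

theorem Exp.sem_compile_shift (e : Exp Label) {t₀ t₀' : ILTExprZ TVar} {s s' k : ℕ}
    (h : t₀.eval δ + s = t₀'.eval δ + s' + k) (d d' : ℕ → ℝ) (t t' : ℕ) :
    (e.compile t₀ : ILExpr Party Label TVar).sem ρ δ d p₁ p₂ s t =
      (e.compile t₀').sem (ρ.adv k) δ d' p₁ p₂ s' t' := by
  simpa only [Exp.promote_zero] using
    e.sem_compile_promote (ρ := ρ) (j := 0) (h.trans (by simp)) d d' t t'

/-! ### Compiled contracts -/

theorem smartTplus_eval (t₁ t₂ : ILTExpr TVar) :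
    (smartTplus t₁ t₂).eval δ = t₁.eval δ + t₂.eval δ := by
  rcases t₁ with _ | (_ | _) <;> rcases t₂ with _ | (_ | _) <;> rfl

/-- A loop consults its arguments only from its starting time on, so agreement there suffices. -/
theorem loopSem_shift {b f g b' f' g' : ℕ → Option ILVal} {s s' : ℕ}
    (hb : ∀ i, b (s + i) = b' (s' + i)) (hf : ∀ i, f (s + i) = f' (s' + i))
    (hg : ∀ i, g (s + i) = g' (s' + i)) (n : ℕ) :
    loopSem b f g n s = loopSem b' f' g' n s' := by
  induction n generalizing s s' with
  | zero =>
    have h := congrArg₂ (fun v (w : Option ILVal × Option ILVal) => iteSem v w.1 w.2) (hb 0)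
      (Prod.ext (hf 0) (hg 0) : (f (s + 0), g (s + 0)) = (f' (s' + 0), g' (s' + 0)))
    exact h
  | succ n ih =>
    have := ih (s := s + 1) (s' := s' + 1) (fun i => by simpa [add_assoc] using hb (1 + i))
      (fun i => by simpa [add_assoc] using hf (1 + i))
      (fun i => by simpa [add_assoc] using hg (1 + i))
    rw [loopSem, loopSem, this]
    have hb0 := hb 0
    have hf0 := hf 0
    simp only [Nat.add_zero] at hb0 hf0
    rw [hb0, hf0]

theorem loopSem_exists_real {b f g : ℕ → Option ILVal} (hb : ∀ s, ∃ a, b s = some (.bool a))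
    (hf : ∀ s, ∃ r, f s = some (.real r)) (hg : ∀ s, ∃ r, g s = some (.real r)) (n s : ℕ) :
    ∃ r, loopSem b f g n s = some (.real r) := by
  induction n generalizing s with
  | zero =>
    obtain ⟨a, ha⟩ := hb s
    cases a <;> simp [loopSem, iteSem, ha, hf, hg]
  | succ n ih =>
    obtain ⟨a, ha⟩ := hb s
    cases a <;> simp [loopSem, iteSem, ha, hf, ih]

theorem loopSem_of_true {b f g : ℕ → Option ILVal} {s : ℕ} (h : b s = some (.bool true)) (n : ℕ) :
    loopSem b f g n s = f s := by
  cases n <;> simp [loopSem, iteSem, h]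

/-- Without a past there is nothing to cut. -/
theorem sem_cutPayoff_zero (il : ILExpr Party Label TVar) (s : ℕ) :
    (cutPayoff il).sem ρ δ d p₁ p₂ s 0 = il.sem ρ δ d p₁ p₂ s 0 := by
  -- The guard asks for a natural number below `0`. The relative time varies because loops move it.
  induction il generalizing s <;> simp_all [cutPayoff, ILExpr.sem, BinOp.ilSem, iteSem]

/-- Compiled well-typed contracts have a real value. -/
theorem Contr.WellTyped.exists_sem {c : Contr Party Asset Label TVar} (hc : c.WellTyped Λ)
    (hρ : ρ.WellTyped Λ) (t₀ : ILTExpr TVar) (s t : ℕ) :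
    ∃ r : ℝ, (cutPayoff (c.compile t₀)).sem ρ δ d p₁ p₂ s t = some (.real r) := by
  induction hc generalizing t₀ s with
  | zero => exact ⟨0, rfl⟩
  | transfer q₁ q₂ a =>
    by_cases h : t₀.eval δ + s < t <;>
      simp [Contr.compile, cutPayoff, ILExpr.sem, BinOp.ilSem, iteSem, h]
  | scale he _ ih =>
    obtain ⟨v, hv, hv'⟩ := he.exists_sem_compile (δ := δ) (d := d) (p₁ := p₁) (p₂ := p₂) hρ
      (.iltexpr t₀) s t
    obtain ⟨x, rfl⟩ := hv.exists_real
    obtain ⟨r, hr⟩ := ih t₀ s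
    exact ⟨x * r, by
      simp [Contr.compile, cutPayoff, ILExpr.sem, cutPayoff_compile_exp, hv', hr, Val.toIL,
        BinOp.ilSem]⟩
  | translate _ ih => exact ih _ s
  | both _ _ ih₁ ih₂ =>
    obtain ⟨r₁, h₁⟩ := ih₁ t₀ s
    obtain ⟨r₂, h₂⟩ := ih₂ t₀ s
    exact ⟨r₁ + r₂, by simp [Contr.compile, cutPayoff, ILExpr.sem, h₁, h₂, BinOp.ilSem]⟩
  | ifWithin he _ _ ih₁ ih₂ =>
    refine loopSem_exists_real (fun s => ?_) (ih₁ t₀) (ih₂ t₀) _ _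
    obtain ⟨v, hv, hv'⟩ := he.exists_sem_compile (δ := δ) (d := d) (p₁ := p₁) (p₂ := p₂) hρ
      (.iltexpr t₀) s t
    obtain ⟨b, rfl⟩ := hv.exists_bool
    exact ⟨b, by rw [cutPayoff_compile_exp]; exact hv'⟩

/-- Moving the starting time and the current time of a compiled contract amounts to advancing the
environment and the discount function. -/
theorem Contr.sem_shift (c : Contr Party Asset Label TVar) {t₀ t₀' : ILTExpr TVar} {s s' k : ℕ}
    (h : t₀.eval δ + s = t₀'.eval δ + s' + k) (t : ℕ) :
    (cutPayoff (c.compile t₀)).sem ρ δ d p₁ p₂ s (t + k) =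
      (cutPayoff (c.compile t₀')).sem (ρ.adv k) δ (advDisc d k) p₁ p₂ s' t := by
  induction c generalizing t₀ t₀' s s' with
  | zero => rfl
  | transfer q₁ q₂ a =>
    -- Both sides of the guard move by `k`, so its truth value is unchanged.
    simp [Contr.compile, cutPayoff, ILExpr.sem, BinOp.ilSem, h, advDisc]
  | scale e c ih =>
    simp only [Contr.compile, cutPayoff, ILExpr.sem, cutPayoff_compile_exp, ih h]
    rw [e.sem_compile_shift (t₀' := .iltexpr t₀') (s' := s') (k := k)
      (by simp only [ILTExprZ.eval]; lia) d (advDisc d k) (t + k) t]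
  | translate u c ih =>
    exact ih (by simp only [smartTplus_eval]; lia)
  | both c₁ c₂ ih₁ ih₂ =>
    simp only [Contr.compile, cutPayoff, ILExpr.sem, ih₁ h, ih₂ h]
  | ifWithin e u c₁ c₂ ih₁ ih₂ =>
    simp only [Contr.compile, cutPayoff, ILExpr.sem, cutPayoff_compile_exp]
    refine loopSem_shift (fun i => ?_) (fun i => ih₁ (by lia)) (fun i => ih₂ (by lia)) _
    exact e.sem_compile_shift (by simp only [ILTExprZ.eval]; lia) _ _ _ _

end Semantics

/-! ### Reduction -/

/-- The index is only a lower bound on transfer times. Lowering it is needed when an `ifWithin`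
waits: its index drops by one while its first branch stays the same. -/
theorem Contr.HasTyAt.mono {Λ : Label → Ty} {δ : TEnv TVar} {c : Contr Party Asset Label TVar}
    {s t : ℤ} (h : c.HasTyAt Λ δ t) (hst : s ≤ t) : c.HasTyAt Λ δ s := by
  induction h generalizing s with
  | zero => exact .zero s
  | transfer p₁ p₂ a ht => exact .transfer p₁ p₂ a (hst.trans ht)
  | scale he hc ht _ => exact .scale he hc (hst.trans ht)
  | @translate u c t _ ih =>
    -- The rule yields only indices of the form `_ + u`, so `s` is split as `(s - u) + u`.
    have := HasTyAt.translate (te := u) (ih (s := s - u.eval δ) (by lia))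
    simpa using this
  | both _ _ ih₁ ih₂ => exact .both (ih₁ hst) (ih₂ hst)
  | ifWithin he _ _ ih₁ ih₂ => exact .ifWithin he (ih₁ hst) (ih₂ (by lia))

variable [DecidableEq Party] [DecidableEq Asset] {Λ : Label → Ty} {δ : TEnv TVar}
  {ρ' : PExtEnv Label} {c c' : Contr Party Asset Label TVar} {T : Trans Party Asset}

/-- Reduction preserves the value of the compiled contract, at every current time from `1` on. -/
theorem Red.evalAt_eq (h : Red ρ' c T c') {ρ : ExtEnv Label} (hext : Extends ρ ρ') (d : ℕ → ℝ)
    (p₁ p₂ : Party) (t : ℕ) :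
    evalAt δ p₁ p₂ (t + 1) (cutPayoff c.compile₀) ρ d =
      evalAt δ p₁ p₂ t (cutPayoff c'.compile₀) (ρ.adv 1) (advDisc d 1) := by
  -- A condition known in `ρ'` has the same value once compiled and read in `ρ`.
  have hval : ∀ {e : Exp Label} {v : Val}, e.eval ρ' = some v →
      (e.compile (.iltexpr (.texpr (.num 0))) : ILExpr Party Label TVar).sem ρ δ d p₁ p₂ 0 (t + 1)
        = some v.toIL := fun he =>
    Exp.sem_compile_of_eval
      (fun l i v hv => by simpa [ILTExprZ.eval, ILTExpr.eval, TExpr.eval] using hext l i v hv) he _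
  simp only [evalAt, Contr.compile₀] at *
  -- This serves both rules for `scale`: the factor is read in `ρ` on both sides, so it need not be
  -- defined in `ρ'`.
  have hscale : ∀ (e : Exp Label) (c c' : Contr Party Asset Label TVar),
      (cutPayoff (c.compile (.texpr (.num 0)))).sem ρ δ d p₁ p₂ 0 (t + 1) =
        (cutPayoff (c'.compile (.texpr (.num 0)))).sem (ρ.adv 1) δ (advDisc d 1) p₁ p₂ 0 t →
      (cutPayoff ((Contr.scale e c).compile (.texpr (.num 0)))).sem ρ δ d p₁ p₂ 0 (t + 1) =
        (cutPayoff ((Contr.scale (e.promote (-1)) c').compile (.texpr (.num 0)))).sem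
          (ρ.adv 1) δ (advDisc d 1) p₁ p₂ 0 t := by
    intro e c c' ih
    simp only [Contr.compile, cutPayoff, ILExpr.sem, cutPayoff_compile_exp, ih]
    rw [e.sem_compile_promote (t₀' := .iltexpr (.texpr (.num 0))) (s' := 0) (k := 1) (j := -1)
      (by simp)]
  induction h with
  | zero => rfl
  | transfer q₁ q₂ a =>
    -- The payoff is due at `0 < t + 1`, so the guard gives `0`, the value of `zero`.
    simp [Contr.compile, cutPayoff, ILExpr.sem, BinOp.ilSem, iteSem, ILTExpr.eval, TExpr.eval]
  | scale _ _ ih => exact hscale _ _ _ ih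
  | scaleZero _ ih => exact hscale _ _ _ ih
  | translateZero _ ih => exact ih
  | translateSucc n c =>
    exact c.sem_shift (by simp [smartTplus, ILTExpr.eval, TExpr.eval]) t
  | both _ _ ih₁ ih₂ => simp only [Contr.compile, cutPayoff, ILExpr.sem, ih₁, ih₂]
  | ifTrue n he _ ih =>
    rw [← ih]
    simp only [Contr.compile, cutPayoff, ILExpr.sem, cutPayoff_compile_exp]
    exact loopSem_of_true (by exact hval he) _
  | ifFalseZero he _ ih =>
    simp only [← ih, Contr.compile, cutPayoff, ILExpr.sem, cutPayoff_compile_exp, TExpr.eval,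
      loopSem, hval he, Val.toIL, iteSem]
  | @ifFalseSucc e n c₁ c₂ he =>
    simp only [Contr.compile, cutPayoff, ILExpr.sem, cutPayoff_compile_exp, TExpr.eval,
      loopSem, hval he, Val.toIL, iteSem]
    -- The first test failed; the remaining `n` rounds start at relative time `1`, which is relative
    -- time `0` in the advanced environment.
    refine loopSem_shift (fun i => ?_) (fun i => c₁.sem_shift (by lia) t)
      (fun i => c₂.sem_shift (by lia) t) n
    exact e.sem_compile_shift (by push_cast; ring) _ _ _ _

/-! ### Invariants of reduction. -/

theorem Red.templateClosed (h : Red ρ' c T c') (hc : c.TemplateClosed) : c'.TemplateClosed := by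
  induction h with
  | zero => exact .zero
  | transfer => exact .zero
  | scale _ _ ih => cases hc with | scale hc => exact .scale (ih hc)
  | scaleZero _ ih => cases hc with | scale hc => exact .scale (ih hc)
  | translateZero _ ih => cases hc with | translate _ hc => exact ih hc
  | translateSucc n c => cases hc with | translate _ hc => exact .translate n hc
  | both _ _ ih₁ ih₂ => cases hc with | both h₁ h₂ => exact .both (ih₁ h₁) (ih₂ h₂)
  | ifTrue n _ _ ih => cases hc with | ifWithin _ h₁ h₂ => exact ih h₁
  | ifFalseZero _ _ ih => cases hc with | ifWithin _ h₁ h₂ => exact ih h₂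
  | ifFalseSucc n _ => cases hc with | ifWithin _ h₁ h₂ => exact .ifWithin n h₁ h₂

/-- Every bound moves by one day. Under `scale` the promotion also lowers the index of the factor,
so the condition `t ≤ s` survives. -/
theorem Red.hasTyAt (h : Red ρ' c T c') {t : ℤ} (hc : c.HasTyAt Λ δ t) :
    c'.HasTyAt Λ δ (t - 1) := by
  induction h generalizing t with
  | zero => exact .zero _
  | transfer => exact .zero _
  | scale _ _ ih =>
    cases hc with | scale he hc hs => exact .scale (he.promote (-1)) (ih hc) (by lia)
  | scaleZero _ ih =>
    cases hc with | scale he hc hs => exact .scale (he.promote (-1)) (ih hc) (by lia)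
  | translateZero _ ih =>
    cases hc with | translate hc => simpa [TExpr.eval] using ih hc
  | translateSucc n c =>
    cases hc with
    | @translate _ _ t hc =>
      have h := Contr.HasTyAt.translate (te := .num n) hc
      have ht : t + ((TExpr.num (n + 1) : TExpr TVar).eval δ : ℤ) - 1 =
          t + ((TExpr.num n : TExpr TVar).eval δ : ℤ) := by
        simp only [TExpr.eval]; lia
      rwa [ht]
  | both _ _ ih₁ ih₂ => cases hc with | both h₁ h₂ => exact .both (ih₁ h₁) (ih₂ h₂)
  | ifTrue n _ _ ih => cases hc with | ifWithin _ h₁ h₂ => exact ih h₁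
  | ifFalseZero _ _ ih =>
    cases hc with | ifWithin _ h₁ h₂ => exact ih (by simpa [TExpr.eval] using h₂)
  | ifFalseSucc n _ =>
    cases hc with
    | ifWithin he h₁ h₂ =>
      exact .ifWithin he (h₁.mono (by lia)) (h₂.mono (by simp only [TExpr.eval]; lia))

/-- A contract of type `Contr^t` with `t > 0` prescribes no transfers today. -/
theorem Red.eq_zero_of_hasTyAt (h : Red ρ' c T c') {t : ℤ} (hc : c.HasTyAt Λ δ t) (ht : 0 < t) :
    T = 0 := by
  induction h generalizing t with
  | zero => rfl
  | transfer => cases hc; lia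
  | scale _ _ ih =>
    cases hc with | scale _ hc hs => rw [ih hc (by lia), smul_zero]
  | scaleZero _ _ => rfl
  | translateZero _ ih =>
    cases hc with | translate hc => exact ih hc (by simpa [TExpr.eval] using ht)
  | translateSucc n c => rfl
  | both _ _ ih₁ ih₂ => cases hc with | both h₁ h₂ => rw [ih₁ h₁ ht, ih₂ h₂ ht, add_zero]
  | ifTrue n _ _ ih => cases hc with | ifWithin _ h₁ h₂ => exact ih h₁ ht
  | ifFalseZero _ _ ih =>
    cases hc with | ifWithin _ h₁ h₂ => exact ih h₂ (by simpa [TExpr.eval] using ht)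
  | ifFalseSucc n _ => rfl

/-! ### Determinism and existence of reductions. -/

/-- The rules overlap only in `scale` and `scaleZero`; when both apply, the inner transfers vanish
and `v • 0 = 0`. -/
theorem Red.unique (h : Red ρ' c T c') {T₂ : Trans Party Asset}
    {c₂ : Contr Party Asset Label TVar} (h₂ : Red ρ' c T₂ c₂) : T₂ = T ∧ c₂ = c' := by
  induction h generalizing T₂ c₂ with
  | zero => cases h₂; exact ⟨rfl, rfl⟩
  | transfer => cases h₂; exact ⟨rfl, rfl⟩
  | scale he _ ih =>
    cases h₂ with
    | scale he' h =>
      obtain ⟨rfl, rfl⟩ := ih h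
      rw [he] at he'
      cases he'
      exact ⟨rfl, rfl⟩
    | scaleZero h =>
      obtain ⟨rfl, rfl⟩ := ih h
      exact ⟨(smul_zero _).symm, rfl⟩
  | scaleZero _ ih =>
    cases h₂ with
    | scale he' h =>
      obtain ⟨rfl, rfl⟩ := ih h
      exact ⟨smul_zero _, rfl⟩
    | scaleZero h =>
      obtain ⟨-, rfl⟩ := ih h
      exact ⟨rfl, rfl⟩
  | translateZero _ ih => cases h₂ with | translateZero h => exact ih h
  | translateSucc n c => cases h₂; exact ⟨rfl, rfl⟩
  | both _ _ ih₁ ih₂ =>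
    cases h₂ with
    | both h h' =>
      obtain ⟨rfl, rfl⟩ := ih₁ h
      obtain ⟨rfl, rfl⟩ := ih₂ h'
      exact ⟨rfl, rfl⟩
  | ifTrue n he _ ih =>
    cases h₂ with
    | ifTrue _ _ h => exact ih h
    | ifFalseZero he' _ => simp [he] at he'
    | ifFalseSucc _ he' => simp [he] at he'
  | ifFalseZero he _ ih =>
    cases h₂ with
    | ifTrue _ he' _ => simp [he] at he'
    | ifFalseZero _ h => exact ih h
  | ifFalseSucc n he =>
    cases h₂ with
    | ifTrue _ he' _ => simp [he] at he'
    | ifFalseSucc _ _ => exact ⟨rfl, rfl⟩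

/-- Causally typed contracts reduce as soon as the past and the present are known. -/
theorem Contr.HasTyAt.exists_red {ρ : ExtEnv Label} (hρ : ρ.WellTyped Λ) (hext : Extends ρ ρ')
    (hh : ρ'.HistoricallyComplete) (hcl : c.TemplateClosed) {t : ℤ} (hc : c.HasTyAt Λ δ t) :
    ∃ T c', Red ρ' c T c' := by
  induction hc with
  | zero => exact ⟨_, _, .zero⟩
  | transfer p₁ p₂ a _ => exact ⟨_, _, .transfer p₁ p₂ a⟩
  | @scale e c s t he hc _ ih =>
    cases hcl with
    | scale hcl =>
      obtain ⟨T, c', h⟩ := ih hcl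
      -- For `s ≤ 0` the factor depends only on known observables; for `s > 0` it may be unknown,
      -- but nothing is transferred today.
      rcases le_or_gt s 0 with hs | hs
      · obtain ⟨v, hv, hv'⟩ := he.exists_eval hρ hext fun l i hi => hh l i (hi.trans hs)
        obtain ⟨r, rfl⟩ := hv'.exists_real
        exact ⟨_, _, .scale hv h⟩
      · obtain rfl := h.eq_zero_of_hasTyAt hc hs
        exact ⟨_, _, .scaleZero h⟩
  | translate hc ih =>
    cases hcl with
    | translate n hcl =>
      cases n with
      | zero =>
        obtain ⟨T, c', h⟩ := ih hcl
        exact ⟨_, _, .translateZero h⟩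
      | succ n => exact ⟨_, _, .translateSucc n _⟩
  | both _ _ ih₁ ih₂ =>
    cases hcl with
    | both hcl₁ hcl₂ =>
      obtain ⟨T₁, c₁', h₁⟩ := ih₁ hcl₁
      obtain ⟨T₂, c₂', h₂⟩ := ih₂ hcl₂
      exact ⟨_, _, .both h₁ h₂⟩
  | ifWithin he _ _ ih₁ ih₂ =>
    cases hcl with
    | ifWithin n hcl₁ hcl₂ =>
      obtain ⟨v, hv, hv'⟩ := he.exists_eval hρ hext fun l i hi => hh l i hi
      obtain ⟨b, rfl⟩ := hv'.exists_bool
      cases b with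
      | true =>
        obtain ⟨T, c', h⟩ := ih₁ hcl₁
        exact ⟨_, _, .ifTrue n hv h⟩
      | false =>
        cases n with
        | zero =>
          obtain ⟨T, c', h⟩ := ih₂ hcl₂
          exact ⟨_, _, .ifFalseZero hv h⟩
        | succ n => exact ⟨_, _, .ifFalseSucc n hv⟩

/-! ### Reduction in several steps. -/

theorem RedN.evalAt_eq {n : ℕ} (h : RedN ρ' n c c') {ρ : ExtEnv Label} (hext : Extends ρ ρ')
    (d : ℕ → ℝ) (p₁ p₂ : Party) :
    evalAt δ p₁ p₂ n (cutPayoff c.compile₀) ρ d =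
      evalAt δ p₁ p₂ 0 c'.compile₀ (ρ.adv n) (advDisc d n) := by
  induction h generalizing ρ d with
  | refl => rw [ExtEnv.adv_zero, advDisc_zero]; exact sem_cutPayoff_zero _ _
  | step h _ ih =>
    rw [h.evalAt_eq hext, ih (hext.adv 1), ExtEnv.adv_adv, advDisc_advDisc]

theorem RedN.unique {n : ℕ} (h : RedN ρ' n c c') {c₂ : Contr Party Asset Label TVar}
    (h₂ : RedN ρ' n c c₂) : c₂ = c' := by
  induction h with
  | refl => cases h₂; rfl
  | step h _ ih =>
    cases h₂ with
    | step h' h₂ =>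
      obtain ⟨-, rfl⟩ := h.unique h'
      exact ih h₂

theorem Contr.HasTyAt.exists_redN {ρ : ExtEnv Label} (hρ : ρ.WellTyped Λ) (hext : Extends ρ ρ')
    {n : ℕ} (hh : ∀ k < n, (ρ'.adv k).HistoricallyComplete) (hcl : c.TemplateClosed) {t : ℤ}
    (hc : c.HasTyAt Λ δ t) : ∃ c', RedN ρ' n c c' := by
  induction n generalizing ρ ρ' c t with
  | zero => exact ⟨c, .refl ρ' c⟩
  | succ n ih =>
    obtain ⟨T, c₁, h⟩ := hc.exists_red hρ hext (ρ'.adv_zero ▸ hh 0 n.succ_pos) hcl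
    obtain ⟨c', h'⟩ := ih (hρ.adv 1) (hext.adv 1)
      -- Step `k` of the tail takes place at `(ρ'/1)/k = ρ'/(k + 1)`.
      (fun k hk => PExtEnv.adv_adv ρ' 1 k ▸ hh (k + 1) (by lia)) (h.templateClosed hcl)
      (h.hasTyAt hc)
    exact ⟨c', .step h h'⟩

end

end CL

theorem mainTheorem5 {Party Asset Label TVar : Type*} [DecidableEq Party] [DecidableEq Asset]
    (Λ : Label → CL.Ty)
    (ρ : CL.ExtEnv Label) (hρ : CL.ExtEnv.WellTyped Λ ρ)
    (ρ' : CL.PExtEnv Label) (hext : CL.Extends ρ ρ')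
    (d : ℕ → ℝ) (p₁ p₂ : Party) (δ : CL.TEnv TVar)
    (c : CL.Contr Party Asset Label TVar)
    (hty : c.WellTyped Λ) (hcl : c.TemplateClosed) :
    -- one step
    ((∀ (T : CL.Trans Party Asset) (c' : CL.Contr Party Asset Label TVar), CL.Red ρ' c T c' →
        ∃ r : ℝ,
          CL.evalAt δ p₁ p₂ 1 (CL.cutPayoff c.compile₀) ρ d = some (.real r) ∧
          CL.evalAt δ p₁ p₂ 0 c'.compile₀ (CL.ExtEnv.adv ρ 1) (CL.advDisc d 1) =
            some (.real r)) ∧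
      (CL.PExtEnv.HistoricallyComplete ρ' → (∃ t : ℤ, c.HasTyAt Λ δ t) →
        ∃! x : CL.Trans Party Asset × CL.Contr Party Asset Label TVar, CL.Red ρ' c x.1 x.2)) ∧
    -- any number of steps
    (∀ n : ℕ,
      (∀ c' : CL.Contr Party Asset Label TVar, CL.RedN ρ' n c c' →
        ∃ r : ℝ,
          CL.evalAt δ p₁ p₂ n (CL.cutPayoff c.compile₀) ρ d = some (.real r) ∧
          CL.evalAt δ p₁ p₂ 0 c'.compile₀ (CL.ExtEnv.adv ρ n) (CL.advDisc d n) =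
            some (.real r)) ∧
      ((∀ k < n, CL.PExtEnv.HistoricallyComplete (CL.PExtEnv.adv ρ' k)) →
        (∃ t : ℤ, c.HasTyAt Λ δ t) →
        ∃! c' : CL.Contr Party Asset Label TVar, CL.RedN ρ' n c c')) := by
  have steps : ∀ (n : ℕ) (c' : CL.Contr Party Asset Label TVar), CL.RedN ρ' n c c' →
      ∃ r : ℝ,
        CL.evalAt δ p₁ p₂ n (CL.cutPayoff c.compile₀) ρ d = some (.real r) ∧
        CL.evalAt δ p₁ p₂ 0 c'.compile₀ (CL.ExtEnv.adv ρ n) (CL.advDisc d n) =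
          some (.real r) := by
    intro n c' h
    -- The typing of `c` alone gives the real value; the equation carries it over to `c'`, so typing
    -- need not be preserved.
    obtain ⟨r, hr⟩ := hty.exists_sem (δ := δ) (d := d) (p₁ := p₁) (p₂ := p₂) hρ
      (.texpr (.num 0)) 0 n
    exact ⟨r, hr, (h.evalAt_eq hext d p₁ p₂).symm.trans hr⟩
  -- The one-step equation is the case `n = 1`.
  refine ⟨⟨fun T c' h => steps 1 c' (.step h (.refl _ _)), ?_⟩, fun n => ⟨steps n, ?_⟩⟩
  · rintro hh ⟨t, hc⟩
    obtain ⟨T, c', h⟩ := hc.exists_red hρ hext hh hcl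
    exact ⟨(T, c'), h, fun x hx => Prod.ext (h.unique hx).1 (h.unique hx).2⟩
  · rintro hh ⟨t, hc⟩
    obtain ⟨c', h⟩ := hc.exists_redN hρ hext hh hcl
    exact ⟨c', h, fun x hx => h.unique hx⟩
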